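/- **Processes.** Let $\mathcal L,\mathcal R,\mathcal N$ be sets of labels $l$, roles $r,s,q$ and channels $a,b,c$. A qualified role $\rho,\sigma$ is an authorized role $\hat r$ or an unauthorized role $\check r$ ($r\in\mathcal R$); $|\rho|$ denotes its underlying role. Processes, up to renaming of bound channels, are $$P::=0\mid P\,|\,P\mid(\nu a)P\mid a!\rho\,l(b).P\mid a?\rho\,l(b).P\mid a!\rho\,l(\sigma).P\mid a?\rho\,l(r).P ,$$ where $(\nu a)P$ binds $a$ in $P$ and the channel input $a?\rho\,l(b).P$ binds $b$ in $P$. Structural congruence $\equiv$ is the least congruence such that $|$ is commutative and associative with unit $0$, $(\nu a)0\equiv0$, $(\nu a)(\nu b)P\equiv(\nu b)(\nu a)P$, and $(\nu a)P\,|\,Q\equiv(\nu a)(P\,|\,Q)$ for $a$ not free in $Q$. Reduction $\to$ is the least relation that is closed under $|$, $(\nu a)$ and $\equiv$ and contains $$a!\hat s\,l(b).P\,|\,a?\hat r\,l(c).Q\to P\,|\,Q\{b/c\},\qquad a!\hat s\,l(\hat q).P\,|\,a?\hat r\,l(q).Q\to P\,|\,Q\,a{:}\{\hat q/\check q\},$$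 where $a{:}\{\hat q/\check q\}$ replaces $\check q$ by $\hat q$ in the subjects of all prefixes on channel $a$ and in all qualified roles sent on channel $a$. $\to^*$ is its reflexive and transitive closure. A prefix is *unauthorized* if it has one of the forms $a?\check r\,l(b)$, $a!\check r\,l(b)$, $a?\check r\,l(s)$, $a!\check r\,l(\hat s)$, $a!\sigma\,l(\check s)$. A process is an *authorization error* if it is structurally congruent to $(\nu a_1)\cdots(\nu a_n)(\alpha.Q'\,|\,R)$ for some $n\ge0$, $a_1,\dots,a_n$, $Q'$, $R$ and some unauthorized prefix $\alpha$. **Types.** Behavioral types $B$, shared channel types $T$, message types $M$ and polarities $p$ are $$B::=\mathsf{end}\mid B|B\mid\Diamond B\mid p\,l(M).B,\quad T::=l(B),\quad M::=B\mid T\mid r,\quad p::=\,!r\mid{?r}\mid r\to s .$$ The labels of $B$ are those of its prefixes (not those inside message types); $B\#C$ means that $B$ and $C$ have disjoint label sets. $B$ is well formed if $B_1\#B_2$ whenever $B_1|B_2$ occurs in it (also inside message types), and whenever $\Diamond B'$ occurs in it, no prefix $r\to s\;l(M)$ of $B'$ is immediate (i.e. under no other prefix). $\mathsf{matched}(B)$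 holds if $B$ has no prefix with polarity $!r$ or $?r$ (message types not counted). $\equiv$ on types is the least equivalence relation that is a congruence for $|$, $\Diamond$ and $p\,l(M).\_$, such that $|$ is commutative and associative with unit $\mathsf{end}$, $\Diamond\mathsf{end}\equiv\mathsf{end}$, $\Diamond\Diamond B\equiv\Diamond B$ and $\Diamond(B|C)\equiv\Diamond B|\Diamond C$. Subtyping $<:$ is the least transitive relation that contains $\equiv$ and all $p\,l(M).B<:\Diamond\,p\,l(M).B$ with $p$ of the form $!r$ or $?r$, and is preserved by $|$, $\Diamond$ and $p\,l(M).\_$. Splitting $B=C\circ D$ is the least relation that is symmetric in $C,D$ and invariant under $\equiv$ in each of $B,C,D$, with: $B=B\circ\mathsf{end}$; and if $B=C\circ D$, then $\Diamond B=\Diamond C\circ\Diamond D$, $\;r\to s\;l(M).B=\,!r\,l(M).C\circ{?s}\,l(M).D$, $\;p\,l(M).B=p\,l(M).C\circ\Diamond D$ provided $l$ is not a label of $D$, and (if also $B'=C'\circ D'$) $B|B'=(C|C')\circ(D|D')$. **Typing.** $\Delta$ is a finite partial map from channels to well-formed behavioral types, $\Gamma$ one from channels to well-formed shared channel types; $\Delta$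 and $\Gamma$ have disjoint domains in every judgment. $\Delta=\Delta_1\circ\Delta_2$ means that, for each channel, either it is in none of the three domains, or it is in $\mathrm{dom}\,\Delta$ and exactly one of $\mathrm{dom}\,\Delta_1,\mathrm{dom}\,\Delta_2$ with the same type, or it is in all three and its types satisfy $B=B_1\circ B_2$. In a rule, $\Delta_1\circ\Delta_2$ stands for any such $\Delta$, and $\Delta,a:B$ requires $a\notin\mathrm{dom}\,\Delta$. Let $\Sigma,\Xi\subseteq\mathcal N\times\mathcal R$, let $\mathrm{ch}(\Sigma)$ be the first projection of $\Sigma$, $u(a,\check r)=\{(a,r)\}$ and $u(a,\hat r)=\emptyset$. The judgment $\Delta;\Gamma\vdash_\Sigma P$ is defined inductively by the following rules (bound names are chosen fresh): * $\Delta;\Gamma\vdash_\emptyset0$ if all types in $\Delta$ are $\equiv\mathsf{end}$. * $\Delta;\Gamma\vdash_\Sigma(\nu a)P$ if $\Delta;\Gamma,a:l(B)\vdash_\Sigma P$. * $\Delta;\Gamma\vdash_\Sigma(\nu a)P$ if $\Delta,a:B;\Gamma\vdash_\Sigma P$, $\mathsf{matched}(B)$ and $a\notin\mathrm{ch}(\Sigma)$.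 * $\Delta_1\circ\Delta_2;\Gamma\vdash_{\Sigma\cup\Xi}P|Q$ if $\Delta_1;\Gamma\vdash_\Sigma P$ and $\Delta_2;\Gamma\vdash_\Xi Q$. * $\Delta\circ a:B';\Gamma\vdash_{\Sigma\cup u(a,\rho)}a?\rho\,l(s).P$ if $\Delta\circ a:B;\Gamma\vdash_{\Sigma\cup\{(a,s)\}}P$ and $?|\rho|\,l(s).B<:B'$. * $\Delta\circ a:B';\Gamma\vdash_{\Sigma\cup u(a,\rho)\cup u(a,\sigma)}a!\rho\,l(\sigma).P$ if $\Delta\circ a:B;\Gamma\vdash_\Sigma P$ and $!|\rho|\,l(|\sigma|).B<:B'$. * $\Delta\circ a:B'';\Gamma\vdash_{\Sigma\cup u(a,\rho)}a?\rho\,l(b).P$ if $(\Delta\circ a:B),b:B';\Gamma\vdash_\Sigma P$, $?|\rho|\,l(B').B<:B''$ and $b\notin\mathrm{ch}(\Sigma)$. * $(\Delta\circ a:B'')\circ b:B';\Gamma\vdash_{\Sigma\cup u(a,\rho)}a!\rho\,l(b).P$ if $\Delta\circ a:B;\Gamma\vdash_\Sigma P$ and $!|\rho|\,l(B').B<:B''$.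 * $\Delta\circ a:B;\Gamma\vdash_{\Sigma\cup u(a,\rho)}a?\rho\,l(b).P$ if $\Delta\circ a:B';\Gamma,b:T\vdash_\Sigma P$, $?|\rho|\,l(T).B'<:B$ and $b\notin\mathrm{ch}(\Sigma)$. * $\Delta\circ a:B;\Gamma,b:T\vdash_{\Sigma\cup u(a,\rho)}a!\rho\,l(b).P$ if $\Delta\circ a:B';\Gamma,b:T\vdash_\Sigma P$ and $!|\rho|\,l(T).B'<:B$. * $\Delta;\Gamma,a:l(B)\vdash_\Sigma a?\hat r\,l(b).P$ if $\Delta,b:B;\Gamma,a:l(B)\vdash_\Sigma P$ and $b\notin\mathrm{ch}(\Sigma)$. * $\Delta\circ b:B;\Gamma,a:l(B)\vdash_\Sigma a!\hat r\,l(b).P$ if $\Delta;\Gamma,a:l(B)\vdash_\Sigma P$. $P$ is *well typed* if $\Delta;\Gamma\vdash_\emptyset P$ for some $\Delta$ and $\Gamma$. **Corollary (Type safety).** If $P$ is a well-typed process and $P\to^*Q$, then $Q$ is not an authorization error. -/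

import Mathlib

universe u v w

namespace RoleAuth

/-! ## Processes -/

/-- A qualified role `ρ`: authorized or unauthorized. -/
inductive QRole (R : Type v) : Type v
  | auth (r : R) : QRole R
  | unauth (r : R) : QRole R

namespace QRole

/-- The underlying role. -/
def role {R : Type v} : QRole R → R
  | auth r => r
  | unauth r => r

/-- The qualification is "unauthorized". -/
def IsUnauth {R : Type v} : QRole R → Prop
  | auth _ => False
  | unauth _ => True

open Classical in
/-- Replace the unauthorized role `q` by the authorized role `q`, and keep every other
qualified role. -/
noncomputable def authorize {R : Type v} (q : R) (ρ : QRole R) : QRole R :=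
  if ρ = unauth q then auth q else ρ

end QRole

/-- Processes over labels `L` and roles `R` with free channel names taken from `N`, up to renaming
of bound names: the scope of a binder is a process over `Option N`, in which `none` is the bound
name and `some a` is the outer name `a`. -/
inductive Proc (L : Type u) (R : Type v) : Type w → Type (max u v (w + 1))
  /-- inaction `0` -/
  | nil {N : Type w} : Proc L R N
  /-- parallel composition `P | Q` -/
  | par {N : Type w} (P Q : Proc L R N) : Proc L R N
  /-- restriction `(ν x) P` -/
  | res {N : Type w} (P : Proc L R (Option N)) : Proc L R N
  /-- `a!ρ l(b).P`: send the channel `b` -/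
  | send {N : Type w} (a : N) (ρ : QRole R) (l : L) (b : N) (P : Proc L R N) : Proc L R N
  /-- `a?ρ l(x).P`: receive a channel; `x` is bound in `P` -/
  | recv {N : Type w} (a : N) (ρ : QRole R) (l : L) (P : Proc L R (Option N)) : Proc L R N
  /-- `a!ρ l(σ).P`: send the qualified role `σ` -/
  | sendAuth {N : Type w} (a : N) (ρ : QRole R) (l : L) (σ : QRole R) (P : Proc L R N) :
      Proc L R N
  /-- `a?ρ l(r).P`: receive authorization for the role `r` (which is not bound) -/
  | recvAuth {N : Type w} (a : N) (ρ : QRole R) (l : L) (r : R) (P : Proc L R N) : Proc L R N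

namespace Proc

variable {L : Type u} {R : Type v}

/-- (Capture-avoiding) substitution of free names along `f`. -/
def map : {N N' : Type w} → (N → N') → Proc L R N → Proc L R N'
  | _, _, _, nil => nil
  | _, _, f, par P Q => par (P.map f) (Q.map f)
  | _, _, f, res P => res (P.map (Option.map f))
  | _, _, f, send a ρ l b P => send (f a) ρ l (f b) (P.map f)
  | _, _, f, recv a ρ l P => recv (f a) ρ l (P.map (Option.map f))
  | _, _, f, sendAuth a ρ l σ P => sendAuth (f a) ρ l σ (P.map f)
  | _, _, f, recvAuth a ρ l r P => recvAuth (f a) ρ l r (P.map f)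

/-- The process `P` placed in the scope of an additional bound name that it does not use. -/
def lift {N : Type w} (P : Proc L R N) : Proc L R (Option N) := P.map some

/-- `P{b/x}` for the outermost bound name `x`. -/
def subst {N : Type w} (P : Proc L R (Option N)) (b : N) : Proc L R N :=
  P.map (fun x => x.getD b)

/-- Exchange of the two innermost bound names. -/
def swapName {N : Type w} : Option (Option N) → Option (Option N)
  | none => some none
  | some none => none
  | some (some a) => some (some a)

open Classical in
/-- The qualification of `ρ`, occurring in a prefix on channel `c`, after the substitution
`a:{q/unauthorized q}`. -/
noncomputable def authorizeOn {N : Type w} (a : N) (q : R) (c : N) (ρ : QRole R) : QRole R :=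
  if c = a then ρ.authorize q else ρ

/-- The substitution `a:{q/unauthorized q}` of the authorized for the unauthorized role `q`, on the
channel `a` only: it acts on the subjects of the prefixes on `a` and on the qualified roles
that are sent on `a`. -/
noncomputable def authorize : {N : Type w} → N → R → Proc L R N → Proc L R N
  | _, _, _, nil => nil
  | _, a, q, par P Q => par (P.authorize a q) (Q.authorize a q)
  | _, a, q, res P => res (P.authorize (some a) q)
  | _, a, q, send c ρ l b P => send c (authorizeOn a q c ρ) l b (P.authorize a q)
  | _, a, q, recv c ρ l P => recv c (authorizeOn a q c ρ) l (P.authorize (some a) q)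
  | _, a, q, sendAuth c ρ l σ P =>
      sendAuth c (authorizeOn a q c ρ) l (authorizeOn a q c σ) (P.authorize a q)
  | _, a, q, recvAuth c ρ l r P => recvAuth c (authorizeOn a q c ρ) l r (P.authorize a q)

/-- Structural congruence `≡`. -/
inductive SCong : {N : Type w} → Proc L R N → Proc L R N → Prop
  | refl {N : Type w} (P : Proc L R N) : SCong P P
  | symm {N : Type w} {P Q : Proc L R N} : SCong P Q → SCong Q P
  | trans {N : Type w} {P Q S : Proc L R N} : SCong P Q → SCong Q S → SCong P S
  | par_nil {N : Type w} (P : Proc L R N) : SCong (par P nil) P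
  | par_comm {N : Type w} (P Q : Proc L R N) : SCong (par P Q) (par Q P)
  | par_assoc {N : Type w} (P Q S : Proc L R N) :
      SCong (par (par P Q) S) (par P (par Q S))
  | res_nil {N : Type w} : SCong (res (nil : Proc L R (Option N))) nil
  | res_swap {N : Type w} (P : Proc L R (Option (Option N))) :
      SCong (res (res P)) (res (res (P.map swapName)))
  | res_par {N : Type w} (P : Proc L R (Option N)) (Q : Proc L R N) :
      SCong (par (res P) Q) (res (par P Q.lift))
  | congr_par {N : Type w} {P P' Q Q' : Proc L R N} :
      SCong P P' → SCong Q Q' → SCong (par P Q) (par P' Q')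
  | congr_res {N : Type w} {P P' : Proc L R (Option N)} : SCong P P' → SCong (res P) (res P')
  | congr_send {N : Type w} (a : N) (ρ : QRole R) (l : L) (b : N) {P P' : Proc L R N} :
      SCong P P' → SCong (send a ρ l b P) (send a ρ l b P')
  | congr_recv {N : Type w} (a : N) (ρ : QRole R) (l : L) {P P' : Proc L R (Option N)} :
      SCong P P' → SCong (recv a ρ l P) (recv a ρ l P')
  | congr_sendAuth {N : Type w} (a : N) (ρ : QRole R) (l : L) (σ : QRole R)
      {P P' : Proc L R N} :
      SCong P P' → SCong (sendAuth a ρ l σ P) (sendAuth a ρ l σ P')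
  | congr_recvAuth {N : Type w} (a : N) (ρ : QRole R) (l : L) (r : R) {P P' : Proc L R N} :
      SCong P P' → SCong (recvAuth a ρ l r P) (recvAuth a ρ l r P')

/-- The reduction relation `→`. -/
inductive Red : {N : Type w} → Proc L R N → Proc L R N → Prop
  | comm {N : Type w} (a : N) (s r : R) (l : L) (b : N) (P : Proc L R N)
      (Q : Proc L R (Option N)) :
      Red (par (send a (.auth s) l b P) (recv a (.auth r) l Q)) (par P (Q.subst b))
  | auth {N : Type w} (a : N) (s r : R) (l : L) (q : R) (P Q : Proc L R N) :
      Red (par (sendAuth a (.auth s) l (.auth q) P) (recvAuth a (.auth r) l q Q))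
        (par P (Q.authorize a q))
  | par {N : Type w} {P P' : Proc L R N} (Q : Proc L R N) :
      Red P P' → Red (par P Q) (par P' Q)
  | res {N : Type w} {P P' : Proc L R (Option N)} : Red P P' → Red (res P) (res P')
  | struct {N : Type w} {P P' Q' Q : Proc L R N} :
      SCong P P' → Red P' Q' → SCong Q' Q → Red P Q

/-- The reflexive and transitive closure `→*`. -/
def Reds {N : Type w} : Proc L R N → Proc L R N → Prop := Relation.ReflTransGen Red

/-- `P` is of the form `α.Q` with `α` an unauthorized prefix: the subject of `α` carries an
unauthorized role, or `α` sends an unauthorized role. -/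
inductive UnauthPrefix : {N : Type w} → Proc L R N → Prop
  | recv {N : Type w} (a : N) (r : R) (l : L) (Q : Proc L R (Option N)) :
      UnauthPrefix (recv a (.unauth r) l Q)
  | send {N : Type w} (a : N) (r : R) (l : L) (b : N) (Q : Proc L R N) :
      UnauthPrefix (send a (.unauth r) l b Q)
  | recvAuth {N : Type w} (a : N) (r : R) (l : L) (s : R) (Q : Proc L R N) :
      UnauthPrefix (recvAuth a (.unauth r) l s Q)
  | sendAuth {N : Type w} (a : N) (r : R) (l : L) (s : R) (Q : Proc L R N) :
      UnauthPrefix (sendAuth a (.unauth r) l (.auth s) Q)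
  | sendUnauth {N : Type w} (a : N) (σ : QRole R) (l : L) (s : R) (Q : Proc L R N) :
      UnauthPrefix (sendAuth a σ l (.unauth s) Q)

/-- The processes `(ν a₁)⋯(ν aₙ)(α.Q | R)` with `n ≥ 0` and `α` an unauthorized prefix. -/
inductive ErrorForm : {N : Type w} → Proc L R N → Prop
  | top {N : Type w} {P : Proc L R N} (S : Proc L R N) : UnauthPrefix P → ErrorForm (par P S)
  | res {N : Type w} {P : Proc L R (Option N)} : ErrorForm P → ErrorForm (res P)

/-- Authorization errors. -/
def AuthError {N : Type w} (P : Proc L R N) : Prop :=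
  ∃ P' : Proc L R N, SCong P P' ∧ ErrorForm P'

end Proc

/-! ## Conversation types -/

/-- Communication capabilities: output `!r`, input `?r`, message exchange `r → s`. -/
inductive Pol (R : Type v) : Type v
  | out (r : R) : Pol R
  | inp (r : R) : Pol R
  | sync (r s : R) : Pol R

mutual

/-- Behavioral types `B`. -/
inductive Beh (L : Type u) (R : Type v) : Type (max u v)
  /-- `end` -/
  | fin : Beh L R
  /-- `B | C` -/
  | par (B C : Beh L R) : Beh L R
  /-- the sometime type `◇ B` -/
  | dia (B : Beh L R) : Beh L R
  /-- `p l(M).B` -/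
  | act (p : Pol R) (l : L) (M : MsgTy L R) (B : Beh L R) : Beh L R

/-- Shared channel types `T = l(B)`. -/
inductive ShTy (L : Type u) (R : Type v) : Type (max u v)
  | mk (l : L) (B : Beh L R) : ShTy L R

/-- Message types `M`. -/
inductive MsgTy (L : Type u) (R : Type v) : Type (max u v)
  | beh (B : Beh L R) : MsgTy L R
  | shared (T : ShTy L R) : MsgTy L R
  | role (r : R) : MsgTy L R

end

namespace Beh

variable {L : Type u} {R : Type v}

/-- The message labels on which a behavior communicates. -/
def labels : Beh L R → Set L
  | fin => ∅
  | par B C => B.labels ∪ C.labels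
  | dia B => B.labels
  | act _ l _ B => {l} ∪ B.labels

/-- Type apartness `B # C`. -/
def Apart (B C : Beh L R) : Prop := Disjoint B.labels C.labels

/-- No immediate action of the type is a message exchange `r → s`. -/
def NoSync : Beh L R → Prop
  | fin => True
  | par B C => B.NoSync ∧ C.NoSync
  | dia B => B.NoSync
  | act (.out _) _ _ _ => True
  | act (.inp _) _ _ _ => True
  | act (.sync _ _) _ _ _ => False

/-- `matched(B)`: there are no output and no input prefixes in `B`. -/
def Matched : Beh L R → Prop
  | fin => True
  | par B C => B.Matched ∧ C.Matched
  | dia B => B.Matched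
  | act (.out _) _ _ _ => False
  | act (.inp _) _ _ _ => False
  | act (.sync _ _) _ _ B => B.Matched

/-- Equivalence of behavioral types: parallel composition is a commutative monoid with unit `end`,
and `◇` is idempotent and distributes over parallel composition. -/
inductive Equiv : Beh L R → Beh L R → Prop
  | refl (B : Beh L R) : Equiv B B
  | symm {B C : Beh L R} : Equiv B C → Equiv C B
  | trans {B C D : Beh L R} : Equiv B C → Equiv C D → Equiv B D
  | par_fin (B : Beh L R) : Equiv (par B fin) B
  | par_comm (B C : Beh L R) : Equiv (par B C) (par C B)
  | par_assoc (B C D : Beh L R) : Equiv (par (par B C) D) (par B (par C D))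
  | dia_fin : Equiv (dia fin) fin
  | dia_dia (B : Beh L R) : Equiv (dia (dia B)) (dia B)
  | dia_par (B C : Beh L R) : Equiv (dia (par B C)) (par (dia B) (dia C))
  | congr_par {B B' C C' : Beh L R} : Equiv B B' → Equiv C C' → Equiv (par B C) (par B' C')
  | congr_dia {B B' : Beh L R} : Equiv B B' → Equiv (dia B) (dia B')
  | congr_act (p : Pol R) (l : L) (M : MsgTy L R) {B B' : Beh L R} :
      Equiv B B' → Equiv (act p l M B) (act p l M B')

/-- Subtyping `B <: C`: an output or input that is available immediately may be used where it
is expected to take place sometime. -/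
inductive Sub : Beh L R → Beh L R → Prop
  | of_equiv {B C : Beh L R} : Equiv B C → Sub B C
  | trans {B C D : Beh L R} : Sub B C → Sub C D → Sub B D
  | out_dia (r : R) (l : L) (M : MsgTy L R) (B : Beh L R) :
      Sub (act (.out r) l M B) (dia (act (.out r) l M B))
  | inp_dia (r : R) (l : L) (M : MsgTy L R) (B : Beh L R) :
      Sub (act (.inp r) l M B) (dia (act (.inp r) l M B))
  | congr_par {B B' C C' : Beh L R} : Sub B B' → Sub C C' → Sub (par B C) (par B' C')
  | congr_dia {B B' : Beh L R} : Sub B B' → Sub (dia B) (dia B')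
  | congr_act (p : Pol R) (l : L) (M : MsgTy L R) {B B' : Beh L R} :
      Sub B B' → Sub (act p l M B) (act p l M B')

/-- Type splitting: `Split B C D` is `B = C ∘ D`. A message exchange splits into the output and the
input that realize it; alternatively one side keeps a whole prefix `p l(M)`, and the part of
the continuation that goes to the other side takes place sometime later there, on labels
different from `l`. -/
inductive Split : Beh L R → Beh L R → Beh L R → Prop
  | fin (B : Beh L R) : Split B B fin
  | comm {B C D : Beh L R} : Split B C D → Split B D C
  | equiv {B B' C C' D D' : Beh L R} :
      Equiv B B' → Equiv C C' → Equiv D D' → Split B' C' D' → Split B C D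
  | par {B B' C C' D D' : Beh L R} :
      Split B C D → Split B' C' D' → Split (par B B') (par C C') (par D D')
  | dia {B C D : Beh L R} : Split B C D → Split (dia B) (dia C) (dia D)
  | sync (r s : R) (l : L) (M : MsgTy L R) {B C D : Beh L R} :
      Split B C D → Split (act (.sync r s) l M B) (act (.out r) l M C) (act (.inp s) l M D)
  | act (p : Pol R) (l : L) (M : MsgTy L R) {B C D : Beh L R} :
      l ∉ D.labels → Split B C D → Split (act p l M B) (act p l M C) (dia D)

end Beh

mutual

/-- Well-formed types: parallel behaviors are apart, and `◇` is not applied to message exchanges. -/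
def Beh.WF {L : Type u} {R : Type v} : Beh L R → Prop
  | .fin => True
  | .par B C => B.WF ∧ C.WF ∧ Beh.Apart B C
  | .dia B => B.WF ∧ B.NoSync
  | .act _ _ M B => M.WF ∧ B.WF

/-- Well-formed shared channel types. -/
def ShTy.WF {L : Type u} {R : Type v} : ShTy L R → Prop
  | .mk _ B => B.WF

/-- Well-formed message types. -/
def MsgTy.WF {L : Type u} {R : Type v} : MsgTy L R → Prop
  | .beh B => B.WF
  | .shared T => T.WF
  | .role _ => True

end

/-! ## Type environments -/

/-- Type environments: partial maps from channel names to types. -/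
abbrev Env (N : Type w) (A : Type u) := N → Option A

namespace Env

variable {N : Type w} {A : Type u} {L : Type u} {R : Type v}

/-- The domain of an environment. -/
def dom (Δ : Env N A) : Set N := {a | (Δ a).isSome}

open Classical in
/-- The environment `a : t`. -/
noncomputable def single (a : N) (t : A) : Env N A := fun c => if c = a then some t else none

/-- The environment `Δ, x : t` in the scope of the new name `x`. -/
def ext (Δ : Env N A) (t : A) : Env (Option N) A
  | none => some t
  | some a => Δ a

/-- The environment `Δ` in the scope of a new name that has no type in it. -/
def lift (Δ : Env N A) : Env (Option N) A
  | none => none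
  | some a => Δ a

/-- Splitting of single entries; an entry may also go to one side as it is. -/
inductive SplitAt : Option (Beh L R) → Option (Beh L R) → Option (Beh L R) → Prop
  | none : SplitAt none none none
  | left (B : Beh L R) : SplitAt (some B) (some B) none
  | right (B : Beh L R) : SplitAt (some B) none (some B)
  | both {B C D : Beh L R} : Beh.Split B C D → SplitAt (some B) (some C) (some D)

/-- `Split Δ Δ₁ Δ₂` is `Δ = Δ₁ ∘ Δ₂`. -/
def Split (Δ Δ₁ Δ₂ : Env N (Beh L R)) : Prop := ∀ a, SplitAt (Δ a) (Δ₁ a) (Δ₂ a)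

/-- The pair `Δ; Γ` separates linear and shared channels, and all its types are well formed. -/
def Valid (Δ : Env N (Beh L R)) (Γ : Env N (ShTy L R)) : Prop :=
  Disjoint Δ.dom Γ.dom ∧ (∀ a B, Δ a = some B → B.WF) ∧ (∀ a T, Γ a = some T → T.WF)

end Env

/-! ## Typing -/

/-- `unauth(a, ρ)`: the pair `(a, r)` if `ρ` is the unauthorized role `r`, and nothing otherwise. -/
def unauthSet {N : Type w} {R : Type v} (a : N) : QRole R → Set (N × R)
  | .auth _ => ∅
  | .unauth r => {(a, r)}

/-- The set `Σ` of pairs, seen in the scope of a new name, which does not occur in it. -/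
def liftAuth {N : Type w} {R : Type v} (A : Set (N × R)) : Set (Option N × R) :=
  Prod.map some id '' A

/-- The typing judgment `Δ; Γ ⊢_Σ P`. Premises on a process under a binder with the authorization
set `liftAuth Σ` say that this set is `Σ` and that the bound name is not among its channels; in
the rule for shared restriction this is no additional condition, since the channels of an
authorization set are always in the domain of the linear environment. -/
inductive Typed {L : Type u} {R : Type v} : {N : Type w} →
    Env N (Beh L R) → Env N (ShTy L R) → Set (N × R) → Proc L R N → Prop
  | t_end {N : Type w} {Δ : Env N (Beh L R)} {Γ : Env N (ShTy L R)}
      (hv : Env.Valid Δ Γ) (hend : ∀ a B, Δ a = some B → Beh.Equiv B .fin) :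
      Typed Δ Γ ∅ .nil
  | t_new {N : Type w} {Δ : Env N (Beh L R)} {Γ : Env N (ShTy L R)} {S : Set (N × R)}
      {B : Beh L R} {P : Proc L R (Option N)}
      (hv : Env.Valid Δ Γ)
      (hP : Typed (Env.ext Δ B) (Env.lift Γ) (liftAuth S) P) (hB : B.Matched) :
      Typed Δ Γ S (.res P)
  | t_snew {N : Type w} {Δ : Env N (Beh L R)} {Γ : Env N (ShTy L R)} {S : Set (N × R)}
      {l : L} {B : Beh L R} {P : Proc L R (Option N)}
      (hv : Env.Valid Δ Γ)
      (hP : Typed (Env.lift Δ) (Env.ext Γ (.mk l B)) (liftAuth S) P) :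
      Typed Δ Γ S (.res P)
  | t_par {N : Type w} {Δ Δ₁ Δ₂ : Env N (Beh L R)} {Γ : Env N (ShTy L R)}
      {S X Y : Set (N × R)} {P Q : Proc L R N}
      (hv : Env.Valid Δ Γ) (hΔ : Env.Split Δ Δ₁ Δ₂)
      (hP : Typed Δ₁ Γ S P) (hQ : Typed Δ₂ Γ X Q) (hY : Y = S ∪ X) :
      Typed Δ Γ Y (.par P Q)
  | t_role_in {N : Type w} {Δ Δ' Δ₀ : Env N (Beh L R)} {Γ : Env N (ShTy L R)}
      {S X : Set (N × R)} {a : N} {ρ : QRole R} {l : L} {s : R} {B B' : Beh L R}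
      {P : Proc L R N}
      (hv : Env.Valid Δ Γ) (hΔ : Env.Split Δ Δ₀ (Env.single a B'))
      (hΔ' : Env.Split Δ' Δ₀ (Env.single a B))
      (hP : Typed Δ' Γ (S ∪ {(a, s)}) P)
      (hsub : Beh.Sub (.act (.inp ρ.role) l (.role s) B) B')
      (hX : X = S ∪ unauthSet a ρ) :
      Typed Δ Γ X (.recvAuth a ρ l s P)
  | t_role_out {N : Type w} {Δ Δ' Δ₀ : Env N (Beh L R)} {Γ : Env N (ShTy L R)}
      {S X : Set (N × R)} {a : N} {ρ σ : QRole R} {l : L} {B B' : Beh L R}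
      {P : Proc L R N}
      (hv : Env.Valid Δ Γ) (hΔ : Env.Split Δ Δ₀ (Env.single a B'))
      (hΔ' : Env.Split Δ' Δ₀ (Env.single a B))
      (hP : Typed Δ' Γ S P)
      (hsub : Beh.Sub (.act (.out ρ.role) l (.role σ.role) B) B')
      (hX : X = S ∪ unauthSet a ρ ∪ unauthSet a σ) :
      Typed Δ Γ X (.sendAuth a ρ l σ P)
  | t_in {N : Type w} {Δ Δ' Δ₀ : Env N (Beh L R)} {Γ : Env N (ShTy L R)}
      {S X : Set (N × R)} {a : N} {ρ : QRole R} {l : L} {B B' B'' : Beh L R}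
      {P : Proc L R (Option N)}
      (hv : Env.Valid Δ Γ) (hΔ : Env.Split Δ Δ₀ (Env.single a B''))
      (hΔ' : Env.Split Δ' Δ₀ (Env.single a B))
      (hP : Typed (Env.ext Δ' B') (Env.lift Γ) (liftAuth S) P)
      (hsub : Beh.Sub (.act (.inp ρ.role) l (.beh B') B) B'')
      (hX : X = S ∪ unauthSet a ρ) :
      Typed Δ Γ X (.recv a ρ l P)
  | t_out {N : Type w} {Δ Δ₁ Δ' Δ₀ : Env N (Beh L R)} {Γ : Env N (ShTy L R)}
      {S X : Set (N × R)} {a b : N} {ρ : QRole R} {l : L} {B B' B'' : Beh L R}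
      {P : Proc L R N}
      (hv : Env.Valid Δ Γ) (hΔ : Env.Split Δ Δ₁ (Env.single b B'))
      (hΔ₁ : Env.Split Δ₁ Δ₀ (Env.single a B''))
      (hΔ' : Env.Split Δ' Δ₀ (Env.single a B))
      (hP : Typed Δ' Γ S P)
      (hsub : Beh.Sub (.act (.out ρ.role) l (.beh B') B) B'')
      (hX : X = S ∪ unauthSet a ρ) :
      Typed Δ Γ X (.send a ρ l b P)
  | t_lsin {N : Type w} {Δ Δ' Δ₀ : Env N (Beh L R)} {Γ : Env N (ShTy L R)}
      {S X : Set (N × R)} {a : N} {ρ : QRole R} {l : L} {B B' : Beh L R} {T : ShTy L R}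
      {P : Proc L R (Option N)}
      (hv : Env.Valid Δ Γ) (hΔ : Env.Split Δ Δ₀ (Env.single a B))
      (hΔ' : Env.Split Δ' Δ₀ (Env.single a B'))
      (hP : Typed (Env.lift Δ') (Env.ext Γ T) (liftAuth S) P)
      (hsub : Beh.Sub (.act (.inp ρ.role) l (.shared T) B') B)
      (hX : X = S ∪ unauthSet a ρ) :
      Typed Δ Γ X (.recv a ρ l P)
  | t_lsout {N : Type w} {Δ Δ' Δ₀ : Env N (Beh L R)} {Γ : Env N (ShTy L R)}
      {S X : Set (N × R)} {a b : N} {ρ : QRole R} {l : L} {B B' : Beh L R} {T : ShTy L R}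
      {P : Proc L R N}
      (hv : Env.Valid Δ Γ) (hΔ : Env.Split Δ Δ₀ (Env.single a B)) (hb : Γ b = some T)
      (hΔ' : Env.Split Δ' Δ₀ (Env.single a B'))
      (hP : Typed Δ' Γ S P)
      (hsub : Beh.Sub (.act (.out ρ.role) l (.shared T) B') B)
      (hX : X = S ∪ unauthSet a ρ) :
      Typed Δ Γ X (.send a ρ l b P)
  | t_sin {N : Type w} {Δ : Env N (Beh L R)} {Γ : Env N (ShTy L R)}
      {S : Set (N × R)} {a : N} {r : R} {l : L} {B : Beh L R} {P : Proc L R (Option N)}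
      (hv : Env.Valid Δ Γ) (ha : Γ a = some (.mk l B))
      (hP : Typed (Env.ext Δ B) (Env.lift Γ) (liftAuth S) P) :
      Typed Δ Γ S (.recv a (.auth r) l P)
  | t_sout {N : Type w} {Δ Δ' : Env N (Beh L R)} {Γ : Env N (ShTy L R)}
      {S : Set (N × R)} {a b : N} {r : R} {l : L} {B : Beh L R} {P : Proc L R N}
      (hv : Env.Valid Δ Γ) (ha : Γ a = some (.mk l B))
      (hΔ : Env.Split Δ Δ' (Env.single b B))
      (hP : Typed Δ' Γ S P) :
      Typed Δ Γ S (.send a (.auth r) l b P)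

/-- `P` is well typed: `Δ; Γ ⊢_∅ P` for some (finite) environments `Δ` and `Γ`. -/
def WellTyped {L : Type u} {R : Type v} {N : Type w} (P : Proc L R N) : Prop :=
  ∃ (Δ : Env N (Beh L R)) (Γ : Env N (ShTy L R)), Δ.dom.Finite ∧ Γ.dom.Finite ∧ Typed Δ Γ ∅ P

end RoleAuth

namespace RoleAuth

-- Authorization safety does not depend on the behavioral types. The set in a typing judgment bounds
-- the authorizations that a process may use without having received them, and this bound can be
-- read off the syntax of the process: this is `Proc.Lacks`. It uses inclusions where the typing
-- rules use equalities. So it is monotone in the set, and it remains valid when a reduction removes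
-- a need for an authorization.
--
-- Four facts give the theorem. A typing derivation yields the bound with the same set
-- (`Typed.lacks`). Structural congruence neither creates nor destroys it (`Proc.SCong.lacks_iff`).
-- Reduction preserves it (`Proc.Red.lacks`): a communicated name is substituted for a bound name,
-- on which nothing is lacking, and a communicated role discharges exactly the pair that its
-- receiver was allowed in addition. Finally, an error exposes a pair outside every binder of roles,
-- which the empty set excludes (`Proc.AuthError.not_lacks_empty`). Subject reduction for the types
-- themselves is not needed.

variable {L : Type u} {R : Type v}

-- Authorization sets under renaming and authorization

/-- The authorization set `S`, transported along a substitution of names. -/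
def mapAuth {N N' : Type w} (f : N → N') (S : Set (N × R)) : Set (N' × R) :=
  Prod.map f id '' S

theorem liftAuth_mono {N : Type w} {S X : Set (N × R)} (h : S ⊆ X) :
    liftAuth S ⊆ liftAuth X :=
  Set.image_mono h

theorem liftAuth_union {N : Type w} (S X : Set (N × R)) :
    liftAuth (S ∪ X) = liftAuth S ∪ liftAuth X :=
  Set.image_union _ _ _

theorem liftAuth_singleton {N : Type w} (a : N) (r : R) :
    liftAuth {(a, r)} = {(some a, r)} :=
  Set.image_singleton

theorem liftAuth_empty {N : Type w} : liftAuth (∅ : Set (N × R)) = ∅ :=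
  Set.image_empty _

theorem mapAuth_mono {N N' : Type w} (f : N → N') {S X : Set (N × R)} (h : S ⊆ X) :
    mapAuth f S ⊆ mapAuth f X :=
  Set.image_mono h

theorem mapAuth_union_singleton {N N' : Type w} (f : N → N') (S : Set (N × R)) (a : N) (r : R) :
    mapAuth f (S ∪ {(a, r)}) = mapAuth f S ∪ {(f a, r)} := by
  rw [mapAuth, Set.image_union, Set.image_singleton]
  rfl

theorem mapAuth_liftAuth {N N' : Type w} (f : N → N') (S : Set (N × R)) :
    mapAuth (Option.map f) (liftAuth S) = liftAuth (mapAuth f S) := by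
  simp only [mapAuth, liftAuth, Set.image_image, Prod.map_map]
  rfl

/-- The bound name has no pair in a lifted set, so it does not matter which name replaces it. -/
theorem mapAuth_getD_liftAuth {N : Type w} (b : N) (S : Set (N × R)) :
    mapAuth (fun x : Option N => x.getD b) (liftAuth S) = S := by
  rw [mapAuth, liftAuth, Set.image_image]
  exact Set.image_id S

theorem mapAuth_swapName_liftAuth {N : Type w} (S : Set (N × R)) :
    mapAuth Proc.swapName (liftAuth (liftAuth S)) = liftAuth (liftAuth S) := by
  rw [mapAuth, liftAuth, liftAuth, Set.image_image, Set.image_image, Set.image_image]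
  rfl

theorem unauthSet_map {N N' : Type w} (f : N → N') (a : N) (ρ : QRole R) :
    unauthSet (f a) ρ = mapAuth f (unauthSet a ρ) := by
  cases ρ <;> simp [unauthSet, mapAuth]

open Classical in
-- If the pair contributed by `ρ` is `(a, q)`, the substitution authorizes the role and the pair
-- disappears. Any other pair is left alone and must already lie in `S`.
theorem unauthSet_authorizeOn_subset {N : Type w} {S : Set (N × R)} {a c : N} {q : R}
    {ρ : QRole R} (h : unauthSet c ρ ⊆ S ∪ {(a, q)}) :
    unauthSet c (Proc.authorizeOn a q c ρ) ⊆ S := by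
  cases ρ with
  | auth r => simp [Proc.authorizeOn, QRole.authorize, unauthSet]
  | unauth r =>
    by_cases hc : c = a <;> by_cases hr : r = q <;>
      simp_all [Proc.authorizeOn, QRole.authorize, unauthSet]

namespace Proc

-- The bound on lacking authorizations, and its behavior under renaming

/-- The authorizations that `P` lacks are all in `S`: every unauthorized role `r` in a prefix on the
channel `a` is either listed as `(a, r)` in `S` or under a prefix on `a` that receives the
authorization for `r`. In particular no authorization is lacking on a bound channel. -/
def Lacks : {N : Type w} → Set (N × R) → Proc L R N → Prop
  | _, _, nil => True
  | _, S, par P Q => P.Lacks S ∧ Q.Lacks S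
  | _, S, res P => P.Lacks (liftAuth S)
  | _, S, send a ρ _ _ P => unauthSet a ρ ⊆ S ∧ P.Lacks S
  | _, S, recv a ρ _ P => unauthSet a ρ ⊆ S ∧ P.Lacks (liftAuth S)
  | _, S, sendAuth a ρ _ σ P => unauthSet a ρ ⊆ S ∧ unauthSet a σ ⊆ S ∧ P.Lacks S
  | _, S, recvAuth a ρ _ r P => unauthSet a ρ ⊆ S ∧ P.Lacks (S ∪ {(a, r)})

theorem Lacks.mono {N : Type w} {P : Proc L R N} {S X : Set (N × R)}
    (h : P.Lacks S) (hSX : S ⊆ X) : P.Lacks X := by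
  induction P with
  | nil => trivial
  | par P Q ihP ihQ => exact ⟨ihP h.1 hSX, ihQ h.2 hSX⟩
  | res P ih => exact ih (S := liftAuth S) h (liftAuth_mono hSX)
  | send a ρ l b P ih => exact ⟨h.1.trans hSX, ih h.2 hSX⟩
  | recv a ρ l P ih => exact ⟨h.1.trans hSX, ih h.2 (liftAuth_mono hSX)⟩
  | sendAuth a ρ l σ P ih => exact ⟨h.1.trans hSX, h.2.1.trans hSX, ih h.2.2 hSX⟩
  | recvAuth a ρ l r P ih =>
    exact ⟨h.1.trans hSX, ih h.2 (Set.union_subset_union_left _ hSX)⟩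

/-- Injectivity is not required: if `f` identifies channels, a role received on one of them covers
the others as well, which only relaxes the condition. Substitution for a bound name relies on this.
-/
theorem Lacks.map {N N' : Type w} {P : Proc L R N} {S : Set (N × R)}
    (h : P.Lacks S) (f : N → N') : (P.map f).Lacks (mapAuth f S) := by
  induction P generalizing N' with
  | nil => trivial
  | par P Q ihP ihQ => exact ⟨ihP h.1 f, ihQ h.2 f⟩
  | res P ih =>
    have := ih (S := liftAuth S) h (Option.map f)
    rwa [mapAuth_liftAuth] at this
  | send a ρ l b P ih =>
    exact ⟨(unauthSet_map f a ρ).trans_subset (mapAuth_mono f h.1), ih h.2 f⟩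
  | recv a ρ l P ih =>
    have := ih h.2 (Option.map f)
    rw [mapAuth_liftAuth] at this
    exact ⟨(unauthSet_map f a ρ).trans_subset (mapAuth_mono f h.1), this⟩
  | sendAuth a ρ l σ P ih =>
    exact ⟨(unauthSet_map f a ρ).trans_subset (mapAuth_mono f h.1),
      (unauthSet_map f a σ).trans_subset (mapAuth_mono f h.2.1), ih h.2.2 f⟩
  | recvAuth a ρ l r P ih =>
    have := ih h.2 f
    rw [mapAuth_union_singleton] at this
    exact ⟨(unauthSet_map f a ρ).trans_subset (mapAuth_mono f h.1), this⟩

theorem unauthSet_subset_preimage {N N' : Type w} {f : N → N'} {a : N} {ρ : QRole R}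
    {S : Set (N' × R)} (h : unauthSet (f a) ρ ⊆ S) : unauthSet a ρ ⊆ Prod.map f id ⁻¹' S := by
  rw [unauthSet_map] at h
  exact Set.image_subset_iff.mp h

/-- This carries `Lacks.of_map` under binders: `Option.map f` sends only the bound name to the bound
name, and that name has no pair in a lifted set. -/
theorem preimage_liftAuth_subset {N N' : Type w} (f : N → N') (S : Set (N' × R)) :
    Prod.map (Option.map f) id ⁻¹' liftAuth S ⊆ liftAuth (Prod.map f id ⁻¹' S) := by
  rintro ⟨_ | a, r⟩ ⟨⟨b, s⟩, hb, h⟩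
  · simp at h
  · obtain ⟨rfl, rfl⟩ : b = f a ∧ s = r := by simpa using h
    exact ⟨(a, s), hb, rfl⟩

/-- An injective renaming reflects the lack of authorizations. -/
theorem Lacks.of_map {N N' : Type w} {P : Proc L R N} {f : N → N'} (hf : f.Injective)
    {S : Set (N' × R)} (h : (P.map f).Lacks S) : P.Lacks (Prod.map f id ⁻¹' S) := by
  induction P generalizing N' with
  | nil => trivial
  | par P Q ihP ihQ => exact ⟨ihP hf h.1, ihQ hf h.2⟩
  | res P ih =>
    have := ih (Option.map_injective hf) (S := liftAuth S) h
    exact this.mono (preimage_liftAuth_subset f S)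
  | send a ρ l b P ih => exact ⟨unauthSet_subset_preimage h.1, ih hf h.2⟩
  | recv a ρ l P ih =>
    exact ⟨unauthSet_subset_preimage h.1,
      (ih (Option.map_injective hf) h.2).mono (preimage_liftAuth_subset f S)⟩
  | sendAuth a ρ l σ P ih =>
    exact ⟨unauthSet_subset_preimage h.1, unauthSet_subset_preimage h.2.1, ih hf h.2.2⟩
  | recvAuth a ρ l r P ih =>
    refine ⟨unauthSet_subset_preimage h.1, (ih hf h.2).mono ?_⟩
    rintro ⟨b, s⟩ (hb | hb)
    · exact Or.inl hb
    -- Injectivity is essential here: without it the role received on `f a` would also cover other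
    -- channels with the same image, whose pairs the original process does not receive.
    · exact Or.inr (Prod.ext (hf (congrArg Prod.fst hb)) (congrArg Prod.snd hb :))

-- Invariance under structural congruence

/-- This is what scope extrusion needs; the backward renaming works because `some` is injective. -/
theorem lacks_lift_iff {N : Type w} {P : Proc L R N} {S : Set (N × R)} :
    P.lift.Lacks (liftAuth S) ↔ P.Lacks S := by
  refine ⟨fun h => ?_, fun h => h.map some⟩
  have hinj : Function.Injective (Prod.map (some : N → Option N) (id : R → R)) :=
    (Option.some_injective N).prodMap Function.injective_id
  have := Lacks.of_map (Option.some_injective N) h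
  rwa [liftAuth, Set.preimage_image_eq _ hinj] at this

theorem swapName_swapName {N : Type w} (x : Option (Option N)) :
    swapName (swapName x) = x := by
  rcases x with _ | _ | a <;> rfl

theorem lacks_map_swapName_iff {N : Type w} {P : Proc L R (Option (Option N))}
    {S : Set (N × R)} :
    (P.map swapName).Lacks (liftAuth (liftAuth S)) ↔ P.Lacks (liftAuth (liftAuth S)) := by
  constructor
  · intro h
    -- The doubly lifted set mentions neither exchanged name, so its preimage under the involution
    -- is contained in the set itself.
    refine (Lacks.of_map (Function.LeftInverse.injective swapName_swapName) h).mono ?_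
    rintro ⟨x, r⟩ hx
    rw [← mapAuth_swapName_liftAuth]
    exact ⟨_, hx, Prod.ext (swapName_swapName x) rfl⟩
  · intro h
    have := h.map swapName
    rwa [mapAuth_swapName_liftAuth] at this

/-- An equivalence is needed because the congruence is symmetric. Only the exchange of restrictions
and scope extrusion move names; the monoid laws of parallel composition become laws of conjunction.
-/
theorem SCong.lacks_iff {N : Type w} {P Q : Proc L R N} (h : SCong P Q) (S : Set (N × R)) :
    P.Lacks S ↔ Q.Lacks S := by
  induction h with
  | refl => rfl
  | symm _ ih => exact (ih S).symm
  | trans _ _ ih₁ ih₂ => exact (ih₁ S).trans (ih₂ S)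
  | par_nil => exact iff_of_eq (and_true _)
  | par_comm => exact And.comm
  | par_assoc => exact and_assoc
  | res_nil => exact Iff.rfl
  | res_swap P => exact lacks_map_swapName_iff.symm
  | res_par P Q => exact and_congr_right fun _ => lacks_lift_iff.symm
  | congr_par _ _ ih₁ ih₂ => exact and_congr (ih₁ S) (ih₂ S)
  | congr_res _ ih => exact ih _
  | congr_send _ _ _ _ _ ih => exact and_congr_right fun _ => ih _
  | congr_recv _ _ _ _ ih => exact and_congr_right fun _ => ih _
  | congr_sendAuth _ _ _ _ _ ih =>
    exact and_congr_right fun _ => and_congr_right fun _ => ih _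
  | congr_recvAuth _ _ _ _ _ ih => exact and_congr_right fun _ => ih _

-- Preservation under reduction

/-- Nothing is lacking on the bound name, so `b` inherits no new requirement from it. -/
theorem Lacks.subst {N : Type w} {P : Proc L R (Option N)} {S : Set (N × R)}
    (h : P.Lacks (liftAuth S)) (b : N) : (P.subst b).Lacks S := by
  have := h.map fun x => x.getD b
  rwa [mapAuth_getD_liftAuth] at this

/-- The substitution pays off the pair `(a, q)` that the input prefix had added to the bound on its
continuation. -/
theorem Lacks.authorize {N : Type w} {P : Proc L R N} {S : Set (N × R)} {a : N} {q : R}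
    (h : P.Lacks (S ∪ {(a, q)})) : (P.authorize a q).Lacks S := by
  induction P with
  | nil => trivial
  | par P Q ihP ihQ => exact ⟨ihP h.1, ihQ h.2⟩
  | res P ih =>
    rw [Lacks, liftAuth_union, liftAuth_singleton] at h
    exact ih h
  | send c ρ l b P ih => exact ⟨unauthSet_authorizeOn_subset h.1, ih h.2⟩
  | recv c ρ l P ih =>
    rw [Lacks, liftAuth_union, liftAuth_singleton] at h
    exact ⟨unauthSet_authorizeOn_subset h.1, ih h.2⟩
  | sendAuth c ρ l σ P ih =>
    exact ⟨unauthSet_authorizeOn_subset h.1, unauthSet_authorizeOn_subset h.2.1, ih h.2.2⟩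
  | recvAuth c ρ l r P ih =>
    -- The pair received by this prefix joins `S`, so that `(a, q)` is again the last component, as
    -- the induction hypothesis requires.
    rw [Lacks, Set.union_right_comm] at h
    exact ⟨unauthSet_authorizeOn_subset h.1, ih h.2⟩

theorem Red.lacks {N : Type w} {P Q : Proc L R N} (h : Red P Q) {S : Set (N × R)}
    (hP : P.Lacks S) : Q.Lacks S := by
  induction h with
  | comm a s r l b P Q => exact ⟨hP.1.2, Lacks.subst hP.2.2 b⟩
  | auth a s r l q P Q => exact ⟨hP.1.2.2, Lacks.authorize hP.2.2⟩
  | par Q _ ih => exact ⟨ih hP.1, hP.2⟩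
  | res _ ih => exact ih (S := liftAuth S) hP
  | struct h₁ _ h₂ ih => exact (h₂.lacks_iff S).mp (ih ((h₁.lacks_iff S).mp hP))

theorem Reds.lacks {N : Type w} {P Q : Proc L R N} (h : Reds P Q) {S : Set (N × R)}
    (hP : P.Lacks S) : Q.Lacks S := by
  induction h with
  | refl => exact hP
  | tail _ h ih => exact h.lacks ih

-- Errors exceed the empty bound

theorem UnauthPrefix.not_lacks_empty {N : Type w} {P : Proc L R N} (h : UnauthPrefix P) :
    ¬ P.Lacks ∅ := by
  cases h <;> simp [Lacks, unauthSet]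

theorem ErrorForm.not_lacks_empty {N : Type w} {P : Proc L R N} (h : ErrorForm P) :
    ¬ P.Lacks ∅ := by
  induction h with
  | top S h => exact fun hP => h.not_lacks_empty hP.1
  | res _ ih =>
    -- Restriction leaves the empty bound empty, so the exposed prefix is judged against the same
    -- set under all the restrictions.
    rw [Lacks, liftAuth_empty]
    exact ih

theorem AuthError.not_lacks_empty {N : Type w} {P : Proc L R N} (h : AuthError P) :
    ¬ P.Lacks ∅ := by
  obtain ⟨P', hPP', hP'⟩ := h
  rw [hPP'.lacks_iff]
  exact hP'.not_lacks_empty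

end Proc

-- From typing to the syntactic bound

/-- The authorization set of a typing judgment covers all authorizations that the process lacks. -/
theorem Typed.lacks {N : Type w} {Δ : Env N (Beh L R)} {Γ : Env N (ShTy L R)}
    {S : Set (N × R)} {P : Proc L R N} (h : Typed Δ Γ S P) : P.Lacks S := by
  induction h with
  | t_end => trivial
  | t_new _ _ _ ih => exact ih
  | t_snew _ _ ih => exact ih
  | t_par _ _ _ _ hY ihP ihQ =>
    subst hY
    exact ⟨ihP.mono Set.subset_union_left, ihQ.mono Set.subset_union_right⟩
  | t_role_in _ _ _ _ _ hX ih =>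
    subst hX
    exact ⟨Set.subset_union_right,
      ih.mono (Set.union_subset_union_left _ Set.subset_union_left)⟩
  | t_role_out _ _ _ _ _ hX ih =>
    subst hX
    exact ⟨Set.subset_union_right.trans Set.subset_union_left, Set.subset_union_right,
      ih.mono (Set.subset_union_left.trans Set.subset_union_left)⟩
  | t_in _ _ _ _ _ hX ih | t_lsin _ _ _ _ _ hX ih =>
    subst hX
    exact ⟨Set.subset_union_right, ih.mono (liftAuth_mono Set.subset_union_left)⟩
  | t_out _ _ _ _ _ _ hX ih | t_lsout _ _ _ _ _ _ hX ih =>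
    subst hX
    exact ⟨Set.subset_union_right, ih.mono Set.subset_union_left⟩
  | t_sin _ _ _ ih | t_sout _ _ _ _ ih => exact ⟨Set.empty_subset _, ih⟩

end RoleAuth

theorem mainTheorem1 {L : Type*} {R : Type*} {N : Type*} (P Q : RoleAuth.Proc L R N)
    (hP : RoleAuth.WellTyped P) (hPQ : RoleAuth.Proc.Reds P Q) :
    ¬ RoleAuth.Proc.AuthError Q := by
  obtain ⟨Δ, Γ, -, -, hT⟩ := hP
  exact fun hQ => hQ.not_lacks_empty (hPQ.lacks hT.lacks)
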